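/- For subsets $A,B,C\subseteq\{0,1\}^n$ let $f_{(A,B,C)}:\{0,1\}^{n+2}\to\{0,1\}$ be the Boolean function whose value at $(x,a)$, $x\in\{0,1\}^n$, $a\in\{0,1\}^2$, is $\mathbf 1_{x\in A}$ if $a=00$, $\mathbf 1_{x\in B}$ if $a=01$, $\mathbf 1_{x\in C}$ if $a=10$, and $0$ if $a=11$. Put $$F_0=\{f_{(A,B,C)}: |A\cap B\cap C|/2^n\ge 1/16\},\qquad F_1=\{f_{(A,B,A\Delta B)}: A,B\subseteq\{0,1\}^n\},$$ where $\Delta$ denotes symmetric difference. The function state of $f:\{0,1\}^m\to\{0,1\}$ is $|f\rangle=2^{-m/2}\sum_{z\in\{0,1\}^m}|z,f(z)\rangle$. A passive quantum tester using $t$ copies is an arbitrary two-outcome quantum measurement (POVM) applied to $|f\rangle^{\otimes t}$. A $q$-query classical algorithm is a randomized adaptive algorithm that evaluates $f$ at no more than $q$ points and outputs one bit. Either one distinguishes $F_0$ and $F_1$ with probability $2/3$ if, for each $i\in\{0,1\}$ and each $f\in F_i$, it outputs $i$ with probability at least $2/3$. Let $$\mathcal E_0=\mathbb E_{A,B,C}\big[|f_{(A,B,C)}\rangle\langle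 f_{(A,B,C)}|^{\otimes t}\big],\qquad \mathcal E_1=\mathbb E_{A,B}\big[|f_{(A,B,A\Delta B)}\rangle\langle f_{(A,B,A\Delta B)}|^{\otimes t}\big],$$ where $A,B,C$ are independent uniformly random subsets of $\{0,1\}^n$, and let $\Pi$ be the orthogonal projector onto the span of those computational basis states $|x_1,a_1,b_1,\dots,x_t,a_t,b_t\rangle$ ($x_j\in\{0,1\}^n$, $a_j\in\{0,1\}^2$, $b_j\in\{0,1\}$) for which $x_1,\dots,x_t$ are pairwise distinct. Write $\|\cdot\|_1$ for the trace norm when applied to operators. Theorem. For all integers $n,t\ge 0$ the following hold, with constants that are absolute (independent of $n$ and $t$). 1. $F_0$ and $F_1$ are non-empty, and $\|f_0-f_1\|_1=\mathbb E_{z}|f_0(z)-f_1(z)|\ge 1/64$ for all $f_0\in F_0$, $f_1\in F_1$, where $z$ is uniform on $\{0,1\}^{n+2}$. 2. Any passive quantum tester that distinguishes $F_0$ and $F_1$ with probability $2/3$ needs $\Omega(2^{n/2})$ function state copies: there is a constant $c>0$ such that it must use $t\ge c\,2^{n/2}$ copies. 3. $F_0$ and $F_1$ can be distinguished with probability $2/3$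 by a classical algorithm making $\mathcal O(1)$ queries. 4. $\Pi\mathcal E_0\Pi=\Pi\mathcal E_1\Pi$. 5. $\|\mathcal E_0-\Pi\mathcal E_0\Pi\|_1$, $\|\mathcal E_1-\Pi\mathcal E_1\Pi\|_1$ and $\|\mathcal E_0-\mathcal E_1\|_1$ are all at most $\mathcal O(t/2^{n/2})$. -/

import Mathlib

open scoped BigOperators ComplexOrder

noncomputable section

/-- The Boolean cube `{0,1}^n`. -/
abbrev Cube (n : ℕ) : Type := Fin n → Bool

/-- Bit strings of length `n + 2`, written as pairs `(x, a)` with `x` of length `n` and `a` of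
length `2`. -/
abbrev Input (n : ℕ) : Type := Cube n × (Bool × Bool)

/-! ### The Boolean functions encoding triples of sets -/

/-- The function `f_{(A,B,C)}`: on `(x, a)` it is the indicator of `x ∈ A`, `x ∈ B`, `x ∈ C` for
`a = 00, 01, 10` respectively, and it is `0` for `a = 11`. -/
def tripleFun {n : ℕ} (A B C : Finset (Cube n)) : Input n → Bool
  | (x, (false, false)) => decide (x ∈ A)
  | (x, (false, true)) => decide (x ∈ B)
  | (x, (true, false)) => decide (x ∈ C)
  | (_, (true, true)) => false

/-- The functions `f_{(A,B,C)}` with `|A ∩ B ∩ C| / 2^n ≥ 1/16`. -/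
def familyZero (n : ℕ) : Set (Input n → Bool) :=
  {f | ∃ A B C : Finset (Cube n),
    (1 / 16 : ℝ) ≤ ((A ∩ B ∩ C).card : ℝ) / 2 ^ n ∧ f = tripleFun A B C}

/-- The functions `f_{(A,B,A Δ B)}`. -/
def familyOne (n : ℕ) : Set (Input n → Bool) :=
  {f | ∃ A B : Finset (Cube n), f = tripleFun A B (symmDiff A B)}

/-- Normalized `L¹` distance of Boolean functions, `𝔼_x |f x - g x|` with `x` uniform. -/
def l1Dist {X : Type} [Fintype X] (f g : X → Bool) : ℝ :=
  (∑ x, |((f x).toNat : ℝ) - ((g x).toNat : ℝ)|) / Fintype.card X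

/-! ### Function states and passive quantum testers -/

/-- Computational basis labels of `t` registers, each holding an input and an output bit. -/
abbrev Register (X : Type) (t : ℕ) : Type := Fin t → X × Bool

/-- The function state `|f⟩ = |X|^{-1/2} ∑_x |x, f x⟩`, as a coordinate vector. -/
def functionState {X : Type} [Fintype X] (f : X → Bool) : X × Bool → ℂ :=
  fun p => if f p.1 = p.2 then ((1 / Real.sqrt (Fintype.card X) : ℝ) : ℂ) else 0

/-- The rank-one operator `|ψ⟩⟨ψ|`. -/
def ketBra {I : Type} (ψ : I → ℂ) : Matrix I I ℂ := Matrix.vecMulVec ψ (star ψ)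

/-- The tensor power `ρ^{⊗ t}`, in the product basis. -/
def tensorPower {I : Type} (ρ : Matrix I I ℂ) (t : ℕ) : Matrix (Fin t → I) (Fin t → I) ℂ :=
  Matrix.of fun r s => ∏ j, ρ (r j) (s j)

/-- The state `|f⟩⟨f|^{⊗ t}` of `t` copies of the function state. -/
def copies {X : Type} [Fintype X] (f : X → Bool) (t : ℕ) :
    Matrix (Register X t) (Register X t) ℂ :=
  tensorPower (ketBra (functionState f)) t

/-- A passive quantum tester that uses `t` function state copies: an arbitrary two-outcome quantum
measurement (POVM) on the joint `t`-copy system. Every quantum algorithm that acts on the copies,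
with any ancillas and intermediate measurements, and outputs a bit, is of this form. -/
structure PassiveQuantumTester (X : Type) [Fintype X] [DecidableEq X] (t : ℕ) where
  effect : Bool → Matrix (Register X t) (Register X t) ℂ
  posSemidef : ∀ b, (effect b).PosSemidef
  sum_eq_one : ∑ b, effect b = 1

/-- The probability (Born rule) that the tester outputs `b` on `t` copies of `|f⟩`. -/
def PassiveQuantumTester.prob {X : Type} [Fintype X] [DecidableEq X] {t : ℕ}
    (M : PassiveQuantumTester X t) (f : X → Bool) (b : Bool) : ℝ :=
  (M.effect b * copies f t).trace.re

/-- The tester distinguishes `F₀` from `F₁` with probability at least `p`: it outputs `0` on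
members of `F₀` and `1` on members of `F₁`, with probability at least `p` each time. -/
def PassiveQuantumTester.Distinguishes {X : Type} [Fintype X] [DecidableEq X] {t : ℕ}
    (M : PassiveQuantumTester X t) (F₀ F₁ : Set (X → Bool)) (p : ℝ) : Prop :=
  (∀ f ∈ F₀, p ≤ M.prob f false) ∧ (∀ f ∈ F₁, p ≤ M.prob f true)

/-! ### Classical query algorithms -/

/-- Deterministic adaptive query algorithms with a one-bit output. -/
inductive DecisionTree (X : Type) : Type
  | leaf (b : Bool) : DecisionTree X
  | query (x : X) (next : Bool → DecisionTree X) : DecisionTree X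

/-- The output of the algorithm when its queries are answered by `f`. -/
def DecisionTree.eval {X : Type} (f : X → Bool) : DecisionTree X → Bool
  | .leaf b => b
  | .query x next => (next (f x)).eval f

/-- The worst-case number of queries. -/
def DecisionTree.depth {X : Type} : DecisionTree X → ℕ
  | .leaf _ => 0
  | .query _ next => max (next false).depth (next true).depth + 1

/-- A randomized classical algorithm making at most `q` queries: a probability distribution on
deterministic adaptive algorithms making at most `q` queries. -/
structure QueryAlgorithm (X : Type) (q : ℕ) where
  dist : PMF (DecisionTree X)
  depth_le : ∀ T ∈ dist.support, T.depth ≤ q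

/-- The probability that the algorithm outputs `b` when its queries are answered by `f`. -/
def QueryAlgorithm.prob {X : Type} {q : ℕ} (R : QueryAlgorithm X q) (f : X → Bool) (b : Bool) : ℝ :=
  ((R.dist.map (DecisionTree.eval f)) b).toReal

/-- The algorithm distinguishes `F₀` from `F₁` with probability at least `p`. -/
def QueryAlgorithm.Distinguishes {X : Type} {q : ℕ} (R : QueryAlgorithm X q)
    (F₀ F₁ : Set (X → Bool)) (p : ℝ) : Prop :=
  (∀ f ∈ F₀, p ≤ R.prob f false) ∧ (∀ f ∈ F₁, p ≤ R.prob f true)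

/-! ### The averaged `t`-copy states -/

/-- `𝔼_{A,B,C} |f_{(A,B,C)}⟩⟨f_{(A,B,C)}|^{⊗ t}` with `A, B, C` independent uniform subsets of
`{0,1}^n`. -/
def ensembleZero (n t : ℕ) : Matrix (Register (Input n) t) (Register (Input n) t) ℂ :=
  ((Fintype.card (Finset (Cube n)) : ℂ) ^ 3)⁻¹ •
    ∑ A : Finset (Cube n), ∑ B : Finset (Cube n), ∑ C : Finset (Cube n),
      copies (tripleFun A B C) t

/-- `𝔼_{A,B} |f_{(A,B,A Δ B)}⟩⟨f_{(A,B,A Δ B)}|^{⊗ t}` with `A, B` independent uniform subsets of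
`{0,1}^n`. -/
def ensembleOne (n t : ℕ) : Matrix (Register (Input n) t) (Register (Input n) t) ℂ :=
  ((Fintype.card (Finset (Cube n)) : ℂ) ^ 2)⁻¹ •
    ∑ A : Finset (Cube n), ∑ B : Finset (Cube n), copies (tripleFun A B (symmDiff A B)) t

/-- The orthogonal projector onto the span of the basis states `|x₁,a₁,b₁,…,x_t,a_t,b_t⟩` for which
the strings `x₁,…,x_t ∈ {0,1}^n` are pairwise distinct. -/
def distinctProj (n t : ℕ) : Matrix (Register (Input n) t) (Register (Input n) t) ℂ :=
  Matrix.diagonal fun r => if Function.Injective (fun j => (r j).1.1) then 1 else 0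

/-- The trace norm `‖M‖₁`: the sum of the singular values of `M`, that is, of the square roots of
the eigenvalues of `Mᴴ M`. -/
def traceNorm {I : Type} [Fintype I] [DecidableEq I] (M : Matrix I I ℂ) : ℝ :=
  ∑ i, Real.sqrt ((Matrix.isHermitian_conjTranspose_mul_self M).eigenvalues i)

end

/-!
For uniform bits `u`, `v`, any two of `u`, `v`, `u ⊕ v` are independent and uniform, exactly as for
three independent bits. A matrix entry of `|f⟩⟨f|^{⊗ t}` between two basis states of pairwise
distinct `x`-registers constrains at most two of the bits `A(x), B(x), C(x)` at each `x`, one from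
the row and one from the column. Hence the two averaged states have the same compression to the
distinct-input subspace. By the union bound over pairs of registers, each `|f⟩^{⊗ t}` has squared
mass at most `t² / 2^n` outside this subspace, so compressing it costs at most `2 t / 2^{n/2}` in
trace norm.

A tester therefore has almost the same average behaviour on the two ensembles. The second ensemble
lives on `F₁`, and by Chebyshev's inequality all but a fraction `64 / 2^n` of the first one lies in
`F₀`, since the expected density of `A ∩ B ∩ C` is `1/8`.

Classically, and for the distance, the point is that `A ∩ B ∩ (A Δ B)` is empty, while for `F₀` a
uniform sample hits `A ∩ B ∩ C` with probability at least `1/16`: at such an `x` the function is `1`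
at all three addresses, which no member of `F₁` is.
-/

open Matrix WithLp

section TraceNorm

open scoped Matrix.Norms.L2Operator

variable {I : Type} [Fintype I]

lemma norm_star_dotProduct_le (v u : I → ℂ) : ‖star v ⬝ᵥ u‖ ≤ ‖toLp 2 v‖ * ‖toLp 2 u‖ := by
  have h := norm_inner_le_norm (𝕜 := ℂ) (toLp 2 v) (toLp 2 u)
  rwa [EuclideanSpace.inner_toLp_toLp, dotProduct_comm] at h

lemma mul_ketBra_mul_conjTranspose (A : Matrix I I ℂ) (ψ : I → ℂ) :
    A * ketBra ψ * Aᴴ = ketBra (A *ᵥ ψ) := by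
  rw [ketBra, ketBra, mul_vecMulVec, vecMulVec_mul, star_mulVec]

variable [DecidableEq I]

/-- The singular values of a square matrix, indexed like the eigenvalues of `Mᴴ M`. -/
noncomputable def singularValue (M : Matrix I I ℂ) (i : I) : ℝ :=
  √((isHermitian_conjTranspose_mul_self M).eigenvalues i)

lemma singularValue_nonneg (M : Matrix I I ℂ) (i : I) : 0 ≤ singularValue M i :=
  Real.sqrt_nonneg _

lemma traceNorm_eq_sum_singularValue (M : Matrix I I ℂ) :
    traceNorm M = ∑ i, singularValue M i := rfl

lemma exists_unitary_conjTranspose_mul_gram_mul_eq_diagonal (M : Matrix I I ℂ) :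
    ∃ V ∈ unitaryGroup I ℂ, Vᴴ * (Mᴴ * M) * V = diagonal fun i => (singularValue M i : ℂ) ^ 2 := by
  have hH := isHermitian_conjTranspose_mul_self M
  refine ⟨hH.eigenvectorUnitary, hH.eigenvectorUnitary.2, ?_⟩
  have hdiag := hH.conjStarAlgAut_star_eigenvectorUnitary
  rw [Unitary.conjStarAlgAut_star_apply] at hdiag
  refine hdiag.trans (congrArg diagonal (funext fun i => ?_))
  rw [singularValue, ← Complex.ofReal_pow,
    Real.sq_sqrt ((posSemidef_conjTranspose_mul_self M).eigenvalues_nonneg i)]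
  rfl

/-- Singular value decomposition `M = W Σ Vᴴ`. The factor `W` is only a contraction: its columns
at vanishing singular values are `0`. -/
lemma exists_singularValueDecomposition (M : Matrix I I ℂ) :
    ∃ V ∈ unitaryGroup I ℂ, ∃ W : Matrix I I ℂ, ‖W‖ ≤ 1 ∧
      M * V = W * diagonal (fun i => (singularValue M i : ℂ)) ∧
      Wᴴ * M * V = diagonal fun i => (singularValue M i : ℂ) := by
  obtain ⟨V, hV, hgram⟩ := exists_unitary_conjTranspose_mul_gram_mul_eq_diagonal M
  set σ := singularValue M
  have hcompress (τ : I → ℝ) : (M * V * diagonal fun i => (τ i : ℂ))ᴴ * M * V =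
      diagonal fun i => (τ i : ℂ) * (σ i : ℂ) ^ 2 := by
    have hreal : star (fun i => (τ i : ℂ)) = fun i => (τ i : ℂ) := by
      ext i
      simp
    calc _ = diagonal (fun i => (τ i : ℂ)) * (Vᴴ * (Mᴴ * M) * V) := by
          simp only [conjTranspose_mul, diagonal_conjTranspose, hreal, Matrix.mul_assoc]
      _ = _ := by rw [hgram, diagonal_mul_diagonal]
  have hadjoint : (M * V * diagonal fun i => (((σ i)⁻¹ : ℝ) : ℂ))ᴴ * M * V =
      diagonal fun i => (σ i : ℂ) := by
    rw [hcompress]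
    congr! 2 with i
    by_cases h : σ i = 0
    · simp [h]
    · push_cast
      field_simp
  refine ⟨V, hV, M * V * diagonal fun i => (((σ i)⁻¹ : ℝ) : ℂ), ?_, ?_, hadjoint⟩
  · rw [← sq_le_one_iff₀ (norm_nonneg _), sq, ← l2_opNorm_conjTranspose_mul_self,
      ← Matrix.mul_assoc, ← Matrix.mul_assoc, hadjoint, diagonal_mul_diagonal,
      l2_opNorm_diagonal, pi_norm_le_iff_of_nonneg zero_le_one]
    intro i
    by_cases h : σ i = 0 <;> simp [h]
  · have hdefect : M * V * diagonal (fun i => ((1 - (σ i)⁻¹ * σ i : ℝ) : ℂ)) = 0 := by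
      rw [← conjTranspose_mul_self_eq_zero, ← Matrix.mul_assoc, ← Matrix.mul_assoc, hcompress,
        diagonal_mul_diagonal, diagonal_eq_zero]
      ext i
      by_cases h : σ i = 0 <;> simp [h]
    ext i j
    have hentry := congrFun₂ hdefect i j
    rw [mul_diagonal, Matrix.zero_apply] at hentry
    rw [Matrix.mul_assoc _ (diagonal _), diagonal_mul_diagonal, mul_diagonal]
    push_cast at hentry ⊢
    linear_combination hentry

lemma norm_apply_le_l2_opNorm (A : Matrix I I ℂ) (i j : I) : ‖A i j‖ ≤ ‖A‖ := by
  have h := (PiLp.norm_apply_le _ i).trans (l2_opNorm_mulVec A (EuclideanSpace.single j 1))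
  simpa using h

lemma norm_trace_mul_le (U M : Matrix I I ℂ) : ‖(U * M).trace‖ ≤ ‖U‖ * traceNorm M := by
  obtain ⟨V, hV, W, hW, hMV, -⟩ := exists_singularValueDecomposition M
  have htrace : (U * M).trace = ∑ i, (Vᴴ * U * W) i i * singularValue M i := by
    calc (U * M).trace = (U * M * (V * Vᴴ)).trace := by
          rw [← star_eq_conjTranspose V, mem_unitaryGroup_iff.mp hV, Matrix.mul_one]
      _ = (Vᴴ * U * (M * V)).trace := by
          rw [← Matrix.mul_assoc, trace_mul_comm]
          simp only [Matrix.mul_assoc]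
      _ = _ := by
          rw [hMV, ← Matrix.mul_assoc]
          simp only [trace, diag_apply, mul_diagonal]
  have hcontraction : ‖Vᴴ * U * W‖ ≤ ‖U‖ := by
    rw [← star_eq_conjTranspose]
    calc ‖star V * U * W‖ ≤ ‖star V * U‖ * ‖W‖ := norm_mul_le _ _
      _ ≤ ‖U‖ * 1 := by
        rw [CStarRing.norm_mem_unitary_mul U (Unitary.star_mem hV)]
        gcongr
      _ = ‖U‖ := mul_one _
  rw [htrace, traceNorm_eq_sum_singularValue, Finset.mul_sum]
  refine norm_sum_le_of_le _ fun i _ => ?_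
  rw [norm_mul, Complex.norm_of_nonneg (singularValue_nonneg M i)]
  exact mul_le_mul_of_nonneg_right ((norm_apply_le_l2_opNorm _ i i).trans hcontraction)
    (singularValue_nonneg M i)

lemma exists_norm_le_one_trace_mul_eq_traceNorm (M : Matrix I I ℂ) :
    ∃ U : Matrix I I ℂ, ‖U‖ ≤ 1 ∧ (U * M).trace = traceNorm M := by
  obtain ⟨V, hV, W, hW, -, hWMV⟩ := exists_singularValueDecomposition M
  refine ⟨V * Wᴴ, ?_, ?_⟩
  · rwa [CStarRing.norm_mem_unitary_mul _ hV, l2_opNorm_conjTranspose]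
  · rw [Matrix.mul_assoc, trace_mul_comm, hWMV, trace_diagonal, traceNorm_eq_sum_singularValue,
      Complex.ofReal_sum]

lemma traceNorm_le_of_forall_norm_trace_mul_le {M : Matrix I I ℂ} {b : ℝ}
    (h : ∀ U : Matrix I I ℂ, ‖U‖ ≤ 1 → ‖(U * M).trace‖ ≤ b) : traceNorm M ≤ b := by
  obtain ⟨U, hU, hUM⟩ := exists_norm_le_one_trace_mul_eq_traceNorm M
  have hle := h U hU
  rw [hUM, Complex.norm_real] at hle
  exact (le_abs_self _).trans hle

lemma norm_trace_mul_le_traceNorm {U : Matrix I I ℂ} (hU : ‖U‖ ≤ 1) (M : Matrix I I ℂ) :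
    ‖(U * M).trace‖ ≤ traceNorm M :=
  (norm_trace_mul_le U M).trans <| mul_le_of_le_one_left
    (Finset.sum_nonneg fun i _ => singularValue_nonneg M i) hU

lemma traceNorm_add_le (M N : Matrix I I ℂ) : traceNorm (M + N) ≤ traceNorm M + traceNorm N :=
  traceNorm_le_of_forall_norm_trace_mul_le fun U hU => by
    rw [Matrix.mul_add, trace_add]
    exact norm_add_le_of_le (norm_trace_mul_le_traceNorm hU M) (norm_trace_mul_le_traceNorm hU N)

lemma traceNorm_smul_le (c : ℂ) (M : Matrix I I ℂ) : traceNorm (c • M) ≤ ‖c‖ * traceNorm M :=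
  traceNorm_le_of_forall_norm_trace_mul_le fun U hU => by
    rw [Matrix.mul_smul, trace_smul, norm_smul]
    exact mul_le_mul_of_nonneg_left (norm_trace_mul_le_traceNorm hU M) (norm_nonneg c)

lemma traceNorm_zero : traceNorm (0 : Matrix I I ℂ) = 0 :=
  le_antisymm (by simpa using traceNorm_smul_le 0 (0 : Matrix I I ℂ))
    (Finset.sum_nonneg fun i _ => singularValue_nonneg 0 i)

/-- The trace norm, bundled to give access to the library of seminorms. -/
noncomputable def traceSeminorm (I : Type) [Fintype I] [DecidableEq I] :
    Seminorm ℂ (Matrix I I ℂ) :=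
  .ofSMulLE traceNorm traceNorm_zero traceNorm_add_le traceNorm_smul_le

lemma traceSeminorm_apply (M : Matrix I I ℂ) : traceSeminorm I M = traceNorm M := rfl

lemma traceNorm_sub_le (M N : Matrix I I ℂ) : traceNorm (M - N) ≤ traceNorm M + traceNorm N :=
  map_sub_le_add (traceSeminorm I) M N

lemma traceNorm_inv_card_smul_sum_le {ι : Type*} [Fintype ι] [Nonempty ι] {M : ι → Matrix I I ℂ}
    {b : ℝ} (h : ∀ i, traceNorm (M i) ≤ b) :
    traceNorm ((Fintype.card ι : ℂ)⁻¹ • ∑ i, M i) ≤ b := by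
  have hsum : traceSeminorm I (∑ i, M i) ≤ ∑ _i : ι, b :=
    (Finset.le_sum_of_subadditive _ (map_zero _).le (map_add_le_add _) _ _).trans
      (Finset.sum_le_sum fun i _ => h i)
  rw [Finset.sum_const, Finset.card_univ, nsmul_eq_mul] at hsum
  rwa [← traceSeminorm_apply, map_smul_eq_mul, norm_inv, Complex.norm_natCast,
    inv_mul_le_iff₀ (Nat.cast_pos.mpr Fintype.card_pos)]

lemma norm_toLp_mulVec_le {U : Matrix I I ℂ} (hU : ‖U‖ ≤ 1) (u : I → ℂ) :
    ‖toLp 2 (U *ᵥ u)‖ ≤ ‖toLp 2 u‖ :=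
  (l2_opNorm_mulVec U (toLp 2 u)).trans (mul_le_of_le_one_left (norm_nonneg _) hU)

lemma traceNorm_vecMulVec_star_le (u v : I → ℂ) :
    traceNorm (vecMulVec u (star v)) ≤ ‖toLp 2 u‖ * ‖toLp 2 v‖ :=
  traceNorm_le_of_forall_norm_trace_mul_le fun U hU => by
    rw [mul_vecMulVec, trace_vecMulVec, dotProduct_comm, mul_comm]
    exact (norm_star_dotProduct_le _ _).trans
      (mul_le_mul_of_nonneg_left (norm_toLp_mulVec_le hU u) (norm_nonneg _))

lemma traceNorm_ketBra_sub_ketBra_le (ψ φ : I → ℂ) :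
    traceNorm (ketBra ψ - ketBra φ) ≤ (‖toLp 2 ψ‖ + ‖toLp 2 φ‖) * ‖toLp 2 (ψ - φ)‖ := by
  have hsplit : ketBra ψ - ketBra φ =
      vecMulVec (ψ - φ) (star ψ) + vecMulVec φ (star (ψ - φ)) := by
    rw [star_sub, sub_vecMulVec, vecMulVec_sub, ketBra, ketBra]
    abel
  rw [hsplit, add_mul, mul_comm ‖toLp 2 ψ‖]
  exact (traceNorm_add_le _ _).trans
    (add_le_add (traceNorm_vecMulVec_star_le _ _) (traceNorm_vecMulVec_star_le _ _))

/-- Gentle measurement: a coordinate projection disturbs a pure state by twice the norm of the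
part it removes. -/
lemma traceNorm_ketBra_sub_diagonal_mul_mul_diagonal_le (P : I → Prop) [DecidablePred P]
    {ψ : I → ℂ} (hψ : ‖toLp 2 ψ‖ ≤ 1) :
    traceNorm (ketBra ψ - diagonal (fun i => if P i then 1 else 0) * ketBra ψ *
      diagonal fun i => if P i then 1 else 0) ≤ 2 * √(∑ i with ¬ P i, ‖ψ i‖ ^ 2) := by
  set D : Matrix I I ℂ := diagonal fun i => if P i then 1 else 0 with hD
  have hselfAdjoint : Dᴴ = D := by
    rw [hD, diagonal_conjTranspose]
    congr 1
    ext i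
    simp [apply_ite]
  have hnorm : ‖D‖ ≤ 1 := by
    rw [hD, l2_opNorm_diagonal, pi_norm_le_iff_of_nonneg zero_le_one]
    intro i
    split_ifs <;> simp
  have hremoved : ‖toLp 2 (ψ - D *ᵥ ψ)‖ = √(∑ i with ¬ P i, ‖ψ i‖ ^ 2) := by
    rw [EuclideanSpace.norm_eq, Finset.sum_filter]
    congr! 2 with i
    by_cases h : P i <;> simp [hD, mulVec_diagonal, h]
  have hproj : D * ketBra ψ * D = ketBra (D *ᵥ ψ) := by
    rw [← mul_ketBra_mul_conjTranspose, hselfAdjoint]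
  rw [hproj, ← hremoved]
  refine (traceNorm_ketBra_sub_ketBra_le _ _).trans
    (mul_le_mul_of_nonneg_right ?_ (norm_nonneg _))
  linarith [norm_toLp_mulVec_le hnorm ψ]

end TraceNorm

section FunctionStates

variable {I X : Type} {t : ℕ}

/-- The tensor power `ψ^{⊗ t}` of a vector, in the product basis. -/
def tensorVector (ψ : I → ℂ) (t : ℕ) : (Fin t → I) → ℂ := fun r => ∏ j, ψ (r j)

lemma tensorPower_ketBra (ψ : I → ℂ) (t : ℕ) :
    tensorPower (ketBra ψ) t = ketBra (tensorVector ψ t) := by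
  ext r s
  simp [tensorPower, ketBra, tensorVector, vecMulVec_apply, Finset.prod_mul_distrib]

/-- The basis label `r`, read as a list of `t` evaluations, agrees with `f`. -/
abbrev RecordsValuesOf (r : Register X t) (f : X → Bool) : Prop := ∀ j, f (r j).1 = (r j).2

variable [Fintype X]

lemma tensorVector_functionState_apply (f : X → Bool) (r : Register X t) :
    tensorVector (functionState f) t r =
      if RecordsValuesOf r f then (((1 / √(Fintype.card X)) ^ t : ℝ) : ℂ) else 0 := by
  simp only [tensorVector, functionState, Fintype.prod_ite_zero, Finset.prod_const,
    Finset.card_univ, Fintype.card_fin, Complex.ofReal_pow]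

lemma copies_apply (f : X → Bool) (r s : Register X t) :
    copies f t r s = if RecordsValuesOf r f ∧ RecordsValuesOf s f then
      ((Fintype.card X : ℂ) ^ t)⁻¹ else 0 := by
  rw [copies, tensorPower_ketBra, ketBra, vecMulVec_apply, Pi.star_apply,
    tensorVector_functionState_apply, tensorVector_functionState_apply, ite_and]
  split_ifs <;> try simp only [star_zero, mul_zero, zero_mul]
  rw [Complex.star_def, Complex.conj_ofReal, ← Complex.ofReal_mul, ← mul_pow, one_div, ← mul_inv,
    Real.mul_self_sqrt (Nat.cast_nonneg _), inv_pow]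
  push_cast
  rfl

lemma sum_filter_norm_sq_tensorVector_functionState (f : X → Bool) (P : (Fin t → X) → Prop)
    [DecidablePred P] :
    ∑ r : Register X t with P (fun j => (r j).1), ‖tensorVector (functionState f) t r‖ ^ 2 =
      ((Finset.univ.filter P).card : ℝ) / (Fintype.card X : ℝ) ^ t := by
  have hamplitude (r : Register X t) : ‖tensorVector (functionState f) t r‖ ^ 2 =
      if RecordsValuesOf r f then ((Fintype.card X : ℝ) ^ t)⁻¹ else 0 := by
    rw [tensorVector_functionState_apply, apply_ite norm, ite_pow, Complex.norm_real]
    simp [pow_right_comm _ t 2]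
  have hsplit (z : Fin t → X) : ∑ b : Fin t → Bool,
      (if ∀ j, f (z j) = b j then ((Fintype.card X : ℝ) ^ t)⁻¹ else 0) =
        ((Fintype.card X : ℝ) ^ t)⁻¹ := by
    simp only [← funext_iff (f := fun j => f (z j)), Finset.sum_ite_eq, Finset.mem_univ, if_true]
  rw [Finset.sum_filter,
    ← (Equiv.arrowProdEquivProdArrow (Fin t) (fun _ => X) fun _ => Bool).symm.sum_comp,
    Fintype.sum_prod_type]
  simp only [hamplitude, Equiv.arrowProdEquivProdArrow, Equiv.coe_fn_symm_mk,
    Finset.sum_ite_irrel, hsplit, Finset.sum_const_zero, ← Finset.sum_filter, Finset.sum_const,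
    nsmul_eq_mul, div_eq_mul_inv]

lemma norm_tensorVector_functionState [Nonempty X] (f : X → Bool) (t : ℕ) :
    ‖toLp 2 (tensorVector (functionState f) t)‖ = 1 := by
  rw [EuclideanSpace.norm_eq, Real.sqrt_eq_one]
  have hcard : ((Fintype.card X : ℝ) ^ t) ≠ 0 := by simp
  simpa [hcard] using sum_filter_norm_sq_tensorVector_functionState (t := t) f fun _ => True

lemma trace_copies [Nonempty X] (f : X → Bool) (t : ℕ) : (copies f t).trace = 1 := by
  have hinner : star (tensorVector (functionState f) t) ⬝ᵥ tensorVector (functionState f) t =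
      inner ℂ (toLp 2 (tensorVector (functionState f) t))
        (toLp 2 (tensorVector (functionState f) t)) := by
    rw [EuclideanSpace.inner_toLp_toLp, dotProduct_comm]
  rw [copies, tensorPower_ketBra, ketBra, trace_vecMulVec, dotProduct_comm, hinner,
    inner_self_eq_norm_sq_to_K, norm_tensorVector_functionState, RCLike.ofReal_one, one_pow]

/-- The `t`-copy state of a uniformly random member of a finite family of functions. -/
noncomputable def uniformMixture {ι : Type*} [Fintype ι] (F : ι → X → Bool) (t : ℕ) :
    Matrix (Register X t) (Register X t) ℂ :=
  (Fintype.card ι : ℂ)⁻¹ • ∑ i, copies (F i) t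

variable {ι : Type*} [Fintype ι]

lemma uniformMixture_apply (F : ι → X → Bool) (r s : Register X t) :
    uniformMixture F t r s = (Fintype.card ι : ℂ)⁻¹ *
      (((Finset.univ.filter fun i => RecordsValuesOf r (F i) ∧ RecordsValuesOf s (F i)).card : ℂ) *
        ((Fintype.card X : ℂ) ^ t)⁻¹) := by
  simp only [uniformMixture, Matrix.smul_apply, Matrix.sum_apply, copies_apply, ← Finset.sum_filter,
    Finset.sum_const, smul_eq_mul, nsmul_eq_mul]

lemma traceNorm_uniformMixture_sub_mul_mul_le [DecidableEq X] [Nonempty ι] {F : ι → X → Bool}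
    {A B : Matrix (Register X t) (Register X t) ℂ} {b : ℝ}
    (h : ∀ i, traceNorm (copies (F i) t - A * copies (F i) t * B) ≤ b) :
    traceNorm (uniformMixture F t - A * uniformMixture F t * B) ≤ b := by
  have hdistrib : uniformMixture F t - A * uniformMixture F t * B =
      (Fintype.card ι : ℂ)⁻¹ • ∑ i, (copies (F i) t - A * copies (F i) t * B) := by
    rw [uniformMixture, Matrix.mul_smul, Matrix.smul_mul, ← smul_sub, Matrix.mul_sum,
      Matrix.sum_mul, ← Finset.sum_sub_distrib]
  exact hdistrib ▸ traceNorm_inv_card_smul_sum_le h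

end FunctionStates

section Collisions

variable {ι Y Z : Type*} [Fintype ι] [DecidableEq ι] [Fintype Y] [DecidableEq Y] [Fintype Z]

lemma card_filter_fst_eq_mul_card_le {i j : ι} (hij : i ≠ j) :
    (Finset.univ.filter fun z : ι → Y × Z => (z i).1 = (z j).1).card * Fintype.card Y ≤
      Fintype.card (ι → Y × Z) := by
  rw [← Finset.card_univ (α := Y), ← Finset.card_product]
  refine Finset.card_le_card_of_injOn
    (fun p : (ι → Y × Z) × Y => Function.update p.1 i (p.2, (p.1 i).2))
    (fun _ _ => Finset.mem_univ _) ?_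
  rintro ⟨z, y⟩ hz ⟨z', y'⟩ hz' heq
  have hne (k : ι) (hk : k ≠ i) : z k = z' k := by
    simpa [hk] using congrFun heq k
  have hi : y = y' ∧ (z i).2 = (z' i).2 := by simpa using congrFun heq i
  simp only [Finset.coe_product, Finset.coe_filter, Finset.mem_univ, true_and, Set.mem_prod,
    Set.mem_ofPred_eq] at hz hz'
  refine Prod.ext (funext fun k => ?_) hi.1
  obtain rfl | hk := eq_or_ne k i
  · exact Prod.ext (hz.1.trans ((congrArg Prod.fst (hne j hij.symm)).trans hz'.1.symm)) hi.2
  · exact hne k hk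

lemma card_filter_not_injective_mul_card_le :
    (Finset.univ.filter fun z : ι → Y × Z =>
        ¬ Function.Injective fun j => (z j).1).card * Fintype.card Y ≤
      Fintype.card ι ^ 2 * Fintype.card (ι → Y × Z) := by
  classical
  have hcover : (Finset.univ.filter fun z : ι → Y × Z => ¬ Function.Injective fun j => (z j).1) ⊆
      (Finset.univ.offDiag : Finset (ι × ι)).biUnion fun p =>
        Finset.univ.filter fun z : ι → Y × Z => (z p.1).1 = (z p.2).1 := by
    intro z hz
    obtain ⟨i, j, hij, hne⟩ := Function.not_injective_iff.mp (Finset.mem_filter.mp hz).2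
    exact Finset.mem_biUnion.mpr ⟨(i, j), by simpa using hne, by simpa using hij⟩
  calc _ ≤ (∑ p ∈ (Finset.univ.offDiag : Finset (ι × ι)),
          (Finset.univ.filter fun z : ι → Y × Z => (z p.1).1 = (z p.2).1).card) *
            Fintype.card Y :=
        Nat.mul_le_mul_right _ ((Finset.card_le_card hcover).trans Finset.card_biUnion_le)
    _ ≤ (Finset.univ.offDiag : Finset (ι × ι)).card * Fintype.card (ι → Y × Z) := by
        rw [Finset.sum_mul]
        refine (Finset.sum_le_card_nsmul _ _ _ fun p hp => ?_).trans_eq (smul_eq_mul _ _)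
        exact card_filter_fst_eq_mul_card_le (Finset.mem_offDiag.mp hp).2.2
    _ ≤ _ := by
        refine Nat.mul_le_mul_right _ ?_
        rw [Finset.offDiag_card, sq]
        exact Nat.sub_le _ _

end Collisions

lemma traceNorm_copies_sub_distinct_le {Y Z : Type} [Fintype Y] [DecidableEq Y] [Fintype Z]
    [DecidableEq Z] [Nonempty Y] [Nonempty Z] (f : Y × Z → Bool) (t : ℕ) :
    traceNorm (copies f t -
      diagonal (fun r => if Function.Injective fun j => (r j).1.1 then 1 else 0) * copies f t *
        diagonal fun r => if Function.Injective fun j => (r j).1.1 then 1 else 0) ≤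
      2 * (t / √(Fintype.card Y)) := by
  rw [copies, tensorPower_ketBra]
  refine (traceNorm_ketBra_sub_diagonal_mul_mul_diagonal_le _
    (norm_tensorVector_functionState f t).le).trans (mul_le_mul_of_nonneg_left ?_ zero_le_two)
  rw [sum_filter_norm_sq_tensorVector_functionState f
    fun z : Fin t → Y × Z => ¬ Function.Injective fun j => (z j).1]
  have hcount := card_filter_not_injective_mul_card_le (ι := Fin t) (Y := Y) (Z := Z)
  rw [Fintype.card_fin, Fintype.card_fun, Fintype.card_fin] at hcount
  refine Real.sqrt_le_iff.mpr ⟨by positivity, ?_⟩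
  rw [div_pow, Real.sq_sqrt (Nat.cast_nonneg _), div_le_div_iff₀ (by positivity) (by positivity)]
  exact_mod_cast hcount

section Tables

/-- The entry at address `a` of a table `v` of three bits, listed in the order `00`, `01`, `10`;
the entry at address `11` is `false`, as for `tripleFun`. -/
def tableEntry (v : Bool × Bool × Bool) : Bool × Bool → Bool
  | (false, false) => v.1
  | (false, true) => v.2.1
  | (true, false) => v.2.2
  | (true, true) => false

/-- The function `(x, a) ↦ (g x)_a` given by a family of tables. It is `f_{(A,B,C)}` when `g x`
lists the memberships of `x` in `A`, `B`, `C`. -/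
def tableFun {α : Type*} (g : α → Bool × Bool × Bool) (p : α × (Bool × Bool)) : Bool :=
  tableEntry (g p.1) p.2

/-- The table `(u, v, u ⊕ v)`, which encodes membership in `A`, `B` and `A Δ B`. -/
def appendParity (w : Bool × Bool) : Bool × Bool × Bool := (w.1, w.2, xor w.1 w.2)

lemma appendParity_ne_full (w : Bool × Bool) : appendParity w ≠ (true, true, true) := by
  revert w
  decide

/-- This is the pairwise independence of `u`, `v`, `u ⊕ v` for uniform bits `u`, `v`. -/
lemma card_tableEntry_eq_two_mul_card_tableEntry_appendParity (a₁ a₂ : Bool × Bool) (b₁ b₂ : Bool) :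
    (Finset.univ.filter fun v => tableEntry v a₁ = b₁ ∧ tableEntry v a₂ = b₂).card =
      2 * (Finset.univ.filter fun w =>
        tableEntry (appendParity w) a₁ = b₁ ∧ tableEntry (appendParity w) a₂ = b₂).card := by
  revert a₁ a₂ b₁ b₂
  decide

variable {α : Type} {t : ℕ}

-- An unqueried point imposes no constraint, which is the constraint `tableEntry v 11 = false`.
lemma exists_recordsValuesOf_tableFun_iff {r : Register (α × (Bool × Bool)) t}
    (hr : Function.Injective fun j => (r j).1.1) :
    ∃ (a : α → Bool × Bool) (b : α → Bool), ∀ g : α → Bool × Bool × Bool,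
      RecordsValuesOf r (tableFun g) ↔ ∀ x, tableEntry (g x) (a x) = b x := by
  have hpoint (x : α) : ∃ (a : Bool × Bool) (b : Bool), ∀ v : Bool × Bool × Bool,
      (∀ j, (r j).1.1 = x → tableEntry v (r j).1.2 = (r j).2) ↔ tableEntry v a = b := by
    by_cases hx : ∃ j, (r j).1.1 = x
    · obtain ⟨j, rfl⟩ := hx
      refine ⟨(r j).1.2, (r j).2, fun v => ⟨fun h => h j rfl, fun h k hk => ?_⟩⟩
      rwa [hr hk]
    · exact ⟨(true, true), false, fun v => iff_of_true (fun j hj => absurd ⟨j, hj⟩ hx) rfl⟩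
  choose a b hab using hpoint
  exact ⟨a, b, fun g => ⟨fun h x => (hab x _).mp (by rintro j rfl; exact h j),
    fun h j => (hab _ _).mpr (h _) j rfl⟩⟩

variable [Fintype α] [DecidableEq α]

lemma card_recordsValuesOf_tableFun_eq {r s : Register (α × (Bool × Bool)) t}
    (hr : Function.Injective fun j => (r j).1.1) (hs : Function.Injective fun j => (s j).1.1) :
    (Finset.univ.filter fun g : α → Bool × Bool × Bool =>
        RecordsValuesOf r (tableFun g) ∧ RecordsValuesOf s (tableFun g)).card =
      2 ^ Fintype.card α * (Finset.univ.filter fun w : α → Bool × Bool =>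
        RecordsValuesOf r (tableFun (appendParity ∘ w)) ∧
          RecordsValuesOf s (tableFun (appendParity ∘ w))).card := by
  obtain ⟨a₁, b₁, h₁⟩ := exists_recordsValuesOf_tableFun_iff hr
  obtain ⟨a₂, b₂, h₂⟩ := exists_recordsValuesOf_tableFun_iff hs
  have hpi {γ : Type} [Fintype γ] (e : γ → Bool × Bool × Bool) :
      (Finset.univ.filter fun g : α → γ =>
        RecordsValuesOf r (tableFun (e ∘ g)) ∧ RecordsValuesOf s (tableFun (e ∘ g))).card =
      ∏ x, (Finset.univ.filter fun v =>
        tableEntry (e v) (a₁ x) = b₁ x ∧ tableEntry (e v) (a₂ x) = b₂ x).card := by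
    rw [← Fintype.card_piFinset]
    congr 1
    ext g
    simp only [h₁, h₂, ← forall_and, Finset.mem_filter, Finset.mem_univ, true_and,
      Fintype.mem_piFinset, Function.comp_apply]
  rw [hpi appendParity, ← Finset.card_univ, ← Finset.prod_const, ← Finset.prod_mul_distrib]
  refine (hpi id).trans (Finset.prod_congr rfl fun x _ => ?_)
  exact card_tableEntry_eq_two_mul_card_tableEntry_appendParity _ _ _ _

lemma uniformMixture_tableFun_apply_eq {r s : Register (α × (Bool × Bool)) t}
    (hr : Function.Injective fun j => (r j).1.1) (hs : Function.Injective fun j => (s j).1.1) :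
    uniformMixture tableFun t r s =
      uniformMixture (fun w : α → Bool × Bool => tableFun (appendParity ∘ w)) t r s := by
  have hcard : Fintype.card (α → Bool × Bool × Bool) =
      2 ^ Fintype.card α * Fintype.card (α → Bool × Bool) := by
    simp only [Fintype.card_fun, Fintype.card_prod, mul_pow]
    rw [Fintype.card_bool]
  have hpos : (Fintype.card (α → Bool × Bool) : ℂ) ≠ 0 := Nat.cast_ne_zero.mpr Fintype.card_ne_zero
  rw [uniformMixture_apply, uniformMixture_apply, card_recordsValuesOf_tableFun_eq hr hs, hcard]
  push_cast
  field_simp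

end Tables

section Families

/-- Pairs of subsets of `α`, encoded as `α`-indexed pairs of bits. -/
def subsetPairEquiv (α : Type*) [Fintype α] [DecidableEq α] :
    Finset α × Finset α ≃ (α → Bool × Bool) where
  toFun S x := (decide (x ∈ S.1), decide (x ∈ S.2))
  invFun w := (Finset.univ.filter fun x => (w x).1, Finset.univ.filter fun x => (w x).2)
  left_inv S := by simp
  right_inv w := by simp

/-- Triples of subsets of `α`, encoded as `α`-indexed tables of bits. -/
def subsetTripleEquiv (α : Type*) [Fintype α] [DecidableEq α] :
    Finset α × Finset α × Finset α ≃ (α → Bool × Bool × Bool) where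
  toFun S x := (decide (x ∈ S.1), decide (x ∈ S.2.1), decide (x ∈ S.2.2))
  invFun g := (Finset.univ.filter fun x => (g x).1, Finset.univ.filter fun x => (g x).2.1,
    Finset.univ.filter fun x => (g x).2.2)
  left_inv S := by simp
  right_inv g := by simp

/-- The points at which all three bits of the table are set: the triple intersection. -/
def fullPoints {α : Type*} [Fintype α] (g : α → Bool × Bool × Bool) : Finset α :=
  Finset.univ.filter fun x => g x = (true, true, true)

/-- The density of the triple intersection. -/
noncomputable def fullDensity {α : Type*} [Fintype α] (g : α → Bool × Bool × Bool) : ℝ :=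
  (fullPoints g).card / Fintype.card α

lemma fullDensity_le_one {α : Type*} [Fintype α] (g : α → Bool × Bool × Bool) :
    fullDensity g ≤ 1 :=
  div_le_one_of_le₀ (Nat.cast_le.mpr (Finset.card_le_univ _)) (Nat.cast_nonneg _)

lemma fullPoints_subsetTripleEquiv {α : Type*} [Fintype α] [DecidableEq α] (A B C : Finset α) :
    fullPoints (subsetTripleEquiv α (A, B, C)) = A ∩ B ∩ C := by
  ext x
  simp [fullPoints, subsetTripleEquiv]

lemma fullPoints_appendParity_comp {α : Type*} [Fintype α] (w : α → Bool × Bool) :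
    fullPoints (appendParity ∘ w) = ∅ :=
  Finset.filter_eq_empty_iff.mpr fun x _ => appendParity_ne_full (w x)

variable {n : ℕ}

lemma tripleFun_eq_tableFun (A B C : Finset (Cube n)) :
    tripleFun A B C = tableFun (subsetTripleEquiv (Cube n) (A, B, C)) := by
  ext ⟨x, _ | _, _ | _⟩ <;> rfl

lemma tripleFun_symmDiff_eq_tableFun (A B : Finset (Cube n)) :
    tripleFun A B (symmDiff A B) =
      tableFun (appendParity ∘ subsetPairEquiv (Cube n) (A, B)) := by
  rw [tripleFun_eq_tableFun]
  congr 1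
  ext x : 1
  by_cases hA : x ∈ A <;> by_cases hB : x ∈ B <;>
    simp [subsetTripleEquiv, subsetPairEquiv, appendParity, Finset.mem_symmDiff, hA, hB]

lemma mem_familyZero_iff {f : Input n → Bool} :
    f ∈ familyZero n ↔ ∃ g : Cube n → Bool × Bool × Bool,
      1 / 16 ≤ fullDensity g ∧ tableFun g = f := by
  rw [(subsetTripleEquiv (Cube n)).symm.exists_congr_left]
  simp [familyZero, fullDensity, fullPoints_subsetTripleEquiv, tripleFun_eq_tableFun, eq_comm]

lemma mem_familyOne_iff {f : Input n → Bool} :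
    f ∈ familyOne n ↔ ∃ w : Cube n → Bool × Bool, tableFun (appendParity ∘ w) = f := by
  rw [(subsetPairEquiv (Cube n)).symm.exists_congr_left]
  simp [familyOne, tripleFun_symmDiff_eq_tableFun, eq_comm]

lemma familyZero_nonempty (n : ℕ) : (familyZero n).Nonempty :=
  ⟨_, Finset.univ, Finset.univ, Finset.univ, by norm_num, rfl⟩

lemma familyOne_nonempty (n : ℕ) : (familyOne n).Nonempty := ⟨_, ∅, ∅, rfl⟩

lemma ensembleZero_eq_uniformMixture (n t : ℕ) :
    ensembleZero n t = uniformMixture (tableFun (α := Cube n)) t := by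
  rw [uniformMixture, ← (subsetTripleEquiv (Cube n)).sum_comp,
    ← Fintype.card_congr (subsetTripleEquiv (Cube n)), Fintype.sum_prod_type]
  simp only [ensembleZero, tripleFun_eq_tableFun, Fintype.sum_prod_type, Fintype.card_prod,
    Nat.cast_mul, pow_succ, pow_zero, one_mul, mul_assoc]

lemma ensembleOne_eq_uniformMixture (n t : ℕ) :
    ensembleOne n t =
      uniformMixture (fun w : Cube n → Bool × Bool => tableFun (appendParity ∘ w)) t := by
  rw [uniformMixture, ← (subsetPairEquiv (Cube n)).sum_comp,
    ← Fintype.card_congr (subsetPairEquiv (Cube n)), Fintype.sum_prod_type]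
  simp only [ensembleOne, tripleFun_symmDiff_eq_tableFun, Fintype.card_prod, Nat.cast_mul, sq]

end Families

section Ensembles

variable (n t : ℕ)

lemma distinctProj_mul_ensembleZero_mul_distinctProj :
    distinctProj n t * ensembleZero n t * distinctProj n t =
      distinctProj n t * ensembleOne n t * distinctProj n t := by
  ext r s
  simp only [distinctProj, mul_diagonal, diagonal_mul, ensembleZero_eq_uniformMixture,
    ensembleOne_eq_uniformMixture]
  split_ifs with hr hs
  · rw [uniformMixture_tableFun_apply_eq hr hs]
  all_goals simp only [mul_zero, zero_mul]

lemma traceNorm_copies_sub_distinctProj_le {n : ℕ} (f : Input n → Bool) (t : ℕ) :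
    traceNorm (copies f t - distinctProj n t * copies f t * distinctProj n t) ≤
      2 * (t / (2 : ℝ) ^ ((n : ℝ) / 2)) := by
  have hsqrt : √(Fintype.card (Cube n)) = (2 : ℝ) ^ ((n : ℝ) / 2) := by
    rw [Fintype.card_fun, Fintype.card_bool, Fintype.card_fin, Nat.cast_pow, Nat.cast_ofNat,
      Real.sqrt_eq_rpow, ← Real.rpow_natCast, ← Real.rpow_mul zero_le_two, mul_one_div]
  exact hsqrt ▸ traceNorm_copies_sub_distinct_le f t

lemma traceNorm_ensembleZero_sub_distinctProj_le :
    traceNorm (ensembleZero n t - distinctProj n t * ensembleZero n t * distinctProj n t) ≤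
      2 * (t / (2 : ℝ) ^ ((n : ℝ) / 2)) := by
  rw [ensembleZero_eq_uniformMixture]
  exact traceNorm_uniformMixture_sub_mul_mul_le fun g =>
    traceNorm_copies_sub_distinctProj_le _ t

lemma traceNorm_ensembleOne_sub_distinctProj_le :
    traceNorm (ensembleOne n t - distinctProj n t * ensembleOne n t * distinctProj n t) ≤
      2 * (t / (2 : ℝ) ^ ((n : ℝ) / 2)) := by
  rw [ensembleOne_eq_uniformMixture]
  exact traceNorm_uniformMixture_sub_mul_mul_le fun w =>
    traceNorm_copies_sub_distinctProj_le _ t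

lemma traceNorm_ensembleZero_sub_ensembleOne_le :
    traceNorm (ensembleZero n t - ensembleOne n t) ≤ 4 * (t / (2 : ℝ) ^ ((n : ℝ) / 2)) := by
  have hsplit : ensembleZero n t - ensembleOne n t =
      (ensembleZero n t - distinctProj n t * ensembleZero n t * distinctProj n t) -
        (ensembleOne n t - distinctProj n t * ensembleOne n t * distinctProj n t) := by
    rw [distinctProj_mul_ensembleZero_mul_distinctProj, sub_sub_sub_cancel_right]
  rw [hsplit]
  refine (traceNorm_sub_le _ _).trans ?_
  linarith [traceNorm_ensembleZero_sub_distinctProj_le n t,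
    traceNorm_ensembleOne_sub_distinctProj_le n t]

end Ensembles

section Concentration

open MeasureTheory ProbabilityTheory

lemma meas_pi_le_abs_card_sub_le {ι Ω : Type*} [Fintype ι] [MeasurableSpace Ω] (μ : Measure Ω)
    [IsProbabilityMeasure μ] {S : Set Ω} [DecidablePred (· ∈ S)] (hS : MeasurableSet S) {c : ℝ}
    (hc : 0 < c) :
    (Measure.pi fun _ : ι => μ) {g | c ≤
        |((Finset.univ.filter fun i => g i ∈ S).card : ℝ) - Fintype.card ι * μ.real S|} ≤
      ENNReal.ofReal (Fintype.card ι / (4 * c ^ 2)) := by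
  have hindicator : MemLp (S.indicator (1 : Ω → ℝ)) 2 μ :=
    memLp_indicator_const 2 hS 1 (.inr (measure_ne_top _ _))
  set X : (ι → Ω) → ℝ := ∑ i, fun g => S.indicator 1 (g i) with hX
  have hsummand (i : ι) : MemLp (fun g : ι → Ω => S.indicator (1 : Ω → ℝ) (g i)) 2
      (Measure.pi fun _ => μ) := hindicator.comp_measurePreserving (measurePreserving_eval _ i)
  have hcount (g : ι → Ω) : X g = (Finset.univ.filter fun i => g i ∈ S).card := by
    simp [hX, Set.indicator_apply]
  have hmean : ∫ g, X g ∂(Measure.pi fun _ => μ) = Fintype.card ι * μ.real S := by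
    simp only [hX, Finset.sum_apply]
    rw [integral_finsetSum _ fun i _ => (hsummand i).integrable one_le_two]
    simp only [integral_comp_eval (μ := fun _ => μ) hindicator.aestronglyMeasurable]
    simp [integral_indicator_one hS]
  have hvariance : Var[X; Measure.pi fun _ => μ] ≤ Fintype.card ι / 4 := by
    rw [hX, variance_sum_pi (X := fun _ => S.indicator 1) fun _ => hindicator]
    have hbounded : Var[S.indicator 1; μ] ≤ ((1 - 0) / 2) ^ 2 :=
      variance_le_sq_of_bounded (.of_forall fun ω => by
        by_cases h : ω ∈ S <;> simp [h]) hindicator.aemeasurable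
    rw [Finset.sum_const, Finset.card_univ, nsmul_eq_mul]
    nlinarith [(Nat.cast_nonneg (Fintype.card ι) : (0 : ℝ) ≤ _)]
  have hchebyshev := meas_ge_le_variance_div_sq
    (memLp_finsetSum' Finset.univ fun i _ => hsummand i) hc
  rw [← hX, hmean] at hchebyshev
  simp only [hcount] at hchebyshev
  refine hchebyshev.trans (ENNReal.ofReal_le_ofReal ?_)
  rw [← div_div]
  gcongr

lemma card_filter_le_abs_card_sub_div_le {ι Ω : Type*} [Fintype ι] [DecidableEq ι] [Fintype Ω]
    [DecidableEq Ω] [Nonempty Ω] (S : Finset Ω) {c : ℝ} (hc : 0 < c) :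
    ((Finset.univ.filter fun g : ι → Ω => c ≤
      |((Finset.univ.filter fun i => g i ∈ S).card : ℝ) -
        Fintype.card ι * (S.card / Fintype.card Ω)|).card : ℝ) / Fintype.card (ι → Ω) ≤
      Fintype.card ι / (4 * c ^ 2) := by
  let _ : MeasurableSpace Ω := ⊤
  have huniform : IsProbabilityMeasure (uniformOn (Set.univ : Set Ω)) :=
    isProbabilityMeasure_uniformOn Set.finite_univ Set.univ_nonempty
  have hmass : (uniformOn Set.univ).real (S : Set Ω) = S.card / Fintype.card Ω := by
    rw [Measure.real, uniformOn_univ, Measure.count_apply_finset, ENNReal.toReal_div,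
      ENNReal.toReal_natCast, ENNReal.toReal_natCast]
  have hbound := meas_pi_le_abs_card_sub_le (ι := ι) (uniformOn Set.univ)
    S.finite_toSet.measurableSet hc
  simp only [hmass, SetLike.mem_coe] at hbound
  rw [← uniformOn_pi, Set.pi_univ, uniformOn_univ, ← Finset.coe_filter_univ,
    Measure.count_apply_finset] at hbound
  have hreal := ENNReal.toReal_le_of_le_ofReal (by positivity) hbound
  rwa [ENNReal.toReal_div, ENNReal.toReal_natCast, ENNReal.toReal_natCast] at hreal

lemma card_filter_fullDensity_lt_div_card_le {α : Type*} [Fintype α] [DecidableEq α] [Nonempty α] :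
    ((Finset.univ.filter fun g : α → Bool × Bool × Bool => fullDensity g < 1 / 16).card : ℝ) /
      Fintype.card (α → Bool × Bool × Bool) ≤ 64 / Fintype.card α := by
  have hα : (0 : ℝ) < Fintype.card α := Nat.cast_pos.mpr Fintype.card_pos
  have hdeviation := card_filter_le_abs_card_sub_div_le (ι := α)
    {((true, true, true) : Bool × Bool × Bool)} (c := Fintype.card α / 16) (by positivity)
  have hvalue : (Fintype.card α : ℝ) / (4 * (Fintype.card α / 16) ^ 2) = 64 / Fintype.card α := by
    field_simp
    norm_num
  rw [hvalue] at hdeviation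
  refine le_trans ?_ hdeviation
  gcongr with g
  intro hg
  rw [fullDensity, div_lt_iff₀ hα, fullPoints] at hg
  refine le_trans ?_ (neg_le_abs _)
  simp only [Finset.mem_singleton, Finset.card_singleton, Fintype.card_prod, Fintype.card_bool]
  norm_num
  linarith

end Concentration

section Testers

namespace PassiveQuantumTester

open scoped Matrix.Norms.L2Operator MatrixOrder

variable {X : Type} {ι κ : Type*} [Fintype X] [DecidableEq X] [Fintype ι] [Fintype κ] {t : ℕ}

lemma prob_nonneg (M : PassiveQuantumTester X t) (f : X → Bool) (b : Bool) : 0 ≤ M.prob f b := by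
  rw [prob, copies, tensorPower_ketBra, ketBra, mul_vecMulVec, trace_vecMulVec, dotProduct_comm]
  exact (Complex.nonneg_iff.mp ((M.posSemidef b).dotProduct_mulVec_nonneg _)).1

lemma prob_false_add_prob_true [Nonempty X] (M : PassiveQuantumTester X t) (f : X → Bool) :
    M.prob f false + M.prob f true = 1 := by
  rw [prob, prob, ← Complex.add_re, ← trace_add, ← Matrix.add_mul, add_comm, ← Fintype.sum_bool,
    M.sum_eq_one, Matrix.one_mul, trace_copies, Complex.one_re]

lemma norm_effect_le_one (M : PassiveQuantumTester X t) (b : Bool) : ‖M.effect b‖ ≤ 1 := by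
  have hle : M.effect b ≤ 1 := M.sum_eq_one ▸
    Finset.single_le_sum (fun b _ => (M.posSemidef b).nonneg) (Finset.mem_univ b)
  exact (CStarAlgebra.norm_le_one_iff_of_nonneg _ (M.posSemidef b).nonneg).mpr hle

lemma re_trace_effect_mul_uniformMixture (M : PassiveQuantumTester X t) (F : ι → X → Bool)
    (b : Bool) :
    (M.effect b * uniformMixture F t).trace.re = (∑ i, M.prob (F i) b) / Fintype.card ι := by
  rw [uniformMixture, Matrix.mul_smul, trace_smul, Matrix.mul_sum, trace_sum, smul_eq_mul,
    ← Complex.ofReal_natCast, ← Complex.ofReal_inv, Complex.re_ofReal_mul, Complex.re_sum,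
    div_eq_inv_mul]
  rfl

lemma average_prob_sub_average_prob_le (M : PassiveQuantumTester X t) (F : ι → X → Bool)
    (G : κ → X → Bool) (b : Bool) :
    (∑ i, M.prob (F i) b) / Fintype.card ι - (∑ k, M.prob (G k) b) / Fintype.card κ ≤
      traceNorm (uniformMixture F t - uniformMixture G t) := by
  rw [← re_trace_effect_mul_uniformMixture, ← re_trace_effect_mul_uniformMixture,
    ← Complex.sub_re, ← trace_sub, ← Matrix.mul_sub]
  exact (Complex.re_le_norm _).trans (norm_trace_mul_le_traceNorm (M.norm_effect_le_one b) _)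

lemma Distinguishes.pos_copies [Nonempty X] {F₀ F₁ : Set (X → Bool)} {p : ℝ}
    {M : PassiveQuantumTester X t} (hM : M.Distinguishes F₀ F₁ p) (hp : 1 / 2 < p)
    (h₀ : F₀.Nonempty) (h₁ : F₁.Nonempty) : 0 < t := by
  rw [Nat.pos_iff_ne_zero]
  rintro rfl
  obtain ⟨f₀, hf₀⟩ := h₀
  obtain ⟨f₁, hf₁⟩ := h₁
  have hcopies : copies f₀ 0 = copies f₁ 0 := by ext; simp [copies, tensorPower]
  have hprob : M.prob f₀ true = M.prob f₁ true := by rw [prob, prob, hcopies]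
  linarith [hM.1 f₀ hf₀, hM.2 f₁ hf₁, M.prob_false_add_prob_true f₀]

end PassiveQuantumTester

lemma mul_one_sub_card_div_card_le_sum_div_card {ι : Type*} [Fintype ι] [Nonempty ι] {f : ι → ℝ}
    (hf : ∀ i, 0 ≤ f i) {p : ℝ} (P : ι → Prop) [DecidablePred P] (h : ∀ i, ¬ P i → p ≤ f i) :
    p * (1 - (Finset.univ.filter P).card / Fintype.card ι) ≤ (∑ i, f i) / Fintype.card ι := by
  have hpointwise (i : ι) : p - p * (if P i then 1 else 0) ≤ f i := by
    split_ifs with hi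
    · simpa using hf i
    · simpa using h i hi
  have hsum := Finset.sum_le_sum fun i (_ : i ∈ Finset.univ) => hpointwise i
  rw [Finset.sum_sub_distrib, ← Finset.mul_sum, Finset.sum_boole, Finset.sum_const,
    Finset.card_univ, nsmul_eq_mul] at hsum
  have hcard : (Fintype.card ι : ℝ) ≠ 0 := Nat.cast_ne_zero.mpr Fintype.card_ne_zero
  rw [le_div_iff₀ (by positivity), mul_assoc, sub_mul, div_mul_cancel₀ _ hcard]
  linarith

namespace PassiveQuantumTester

variable {n t : ℕ} {M : PassiveQuantumTester (Input n) t} {p : ℝ}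

lemma Distinguishes.le_average_prob_tableFun (hp : 0 ≤ p)
    (hM : M.Distinguishes (familyZero n) (familyOne n) p) :
    p * (1 - 64 / 2 ^ n) ≤
      (∑ g : Cube n → Bool × Bool × Bool, M.prob (tableFun g) false) /
        Fintype.card (Cube n → Bool × Bool × Bool) := by
  have hsparse := card_filter_fullDensity_lt_div_card_le (α := Cube n)
  have hcube : (Fintype.card (Cube n) : ℝ) = 2 ^ n := by simp
  rw [hcube] at hsparse
  refine le_trans (by gcongr) (mul_one_sub_card_div_card_le_sum_div_card
    (fun g => M.prob_nonneg (tableFun g) false) (fun g => fullDensity g < 1 / 16) fun g hg =>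
      hM.1 _ (mem_familyZero_iff.mpr ⟨g, not_lt.mp hg, rfl⟩))

lemma Distinguishes.average_prob_appendParity_le
    (hM : M.Distinguishes (familyZero n) (familyOne n) p) :
    (∑ w : Cube n → Bool × Bool, M.prob (tableFun (appendParity ∘ w)) false) /
      Fintype.card (Cube n → Bool × Bool) ≤ 1 - p := by
  rw [div_le_iff₀ (Nat.cast_pos.mpr Fintype.card_pos), mul_comm, ← nsmul_eq_mul]
  refine Finset.sum_le_card_nsmul _ _ _ fun w _ => ?_
  linarith [hM.2 _ (mem_familyOne_iff.mpr ⟨w, rfl⟩),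
    M.prob_false_add_prob_true (tableFun (appendParity ∘ w))]

lemma Distinguishes.advantage_le (hp : 0 ≤ p)
    (hM : M.Distinguishes (familyZero n) (familyOne n) p) :
    p * (1 - 64 / 2 ^ n) - (1 - p) ≤ 4 * (t / (2 : ℝ) ^ ((n : ℝ) / 2)) := by
  have hbias := M.average_prob_sub_average_prob_le (tableFun (α := Cube n))
    (fun w => tableFun (appendParity ∘ w)) false
  rw [← ensembleZero_eq_uniformMixture, ← ensembleOne_eq_uniformMixture] at hbias
  linarith [hM.le_average_prob_tableFun hp, hM.average_prob_appendParity_le,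
    traceNorm_ensembleZero_sub_ensembleOne_le n t]

lemma Distinguishes.le_copies (hM : M.Distinguishes (familyZero n) (familyOne n) (2 / 3)) :
    1 / 64 * (2 : ℝ) ^ ((n : ℝ) / 2) ≤ t := by
  by_contra! hlt
  have ht : (1 : ℝ) ≤ t := Nat.one_le_cast.mpr <|
    hM.pos_copies (by norm_num) (familyZero_nonempty n) (familyOne_nonempty n)
  have hadvantage := hM.advantage_le (by norm_num)
  have hsquare : (2 : ℝ) ^ n = ((2 : ℝ) ^ ((n : ℝ) / 2)) ^ 2 := by
    rw [← Real.rpow_natCast, ← Real.rpow_natCast, ← Real.rpow_mul zero_le_two, Nat.cast_ofNat,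
      div_mul_cancel₀ _ two_ne_zero]
  set s := (2 : ℝ) ^ ((n : ℝ) / 2)
  have hs : 64 < s := by linarith
  have hratio : t / s < 1 / 64 := (div_lt_iff₀ (by linarith)).mpr hlt
  have htail : 64 / 2 ^ n < (1 / 64 : ℝ) := by
    rw [hsquare, div_lt_iff₀ (by positivity)]
    nlinarith [hs]
  linarith

end PassiveQuantumTester

end Testers

section Distance

lemma exists_tableEntry_full_ne : ∀ v ≠ (true, true, true),
    ∃ a, tableEntry (true, true, true) a ≠ tableEntry v a := by
  decide

lemma abs_toNat_sub_toNat_eq_ite (b c : Bool) :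
    |(b.toNat : ℝ) - (c.toNat : ℝ)| = if b ≠ c then 1 else 0 := by
  cases b <;> cases c <;> simp

lemma fullDensity_div_four_le_l1Dist {α : Type} [Fintype α] {g h : α → Bool × Bool × Bool}
    (hh : fullPoints h = ∅) : fullDensity g / 4 ≤ l1Dist (tableFun g) (tableFun h) := by
  have hpoint (x : α) : (if g x = (true, true, true) then (1 : ℝ) else 0) ≤
      ∑ a, if tableFun g (x, a) ≠ tableFun h (x, a) then 1 else 0 := by
    split_ifs with hg
    · obtain ⟨a, ha⟩ := exists_tableEntry_full_ne (h x) <|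
        Finset.filter_eq_empty_iff.mp hh (Finset.mem_univ x)
      have hne : tableFun g (x, a) ≠ tableFun h (x, a) := by rwa [tableFun, hg]
      exact (if_pos hne).symm.trans_le (Finset.single_le_sum
        (f := fun a => if tableFun g (x, a) ≠ tableFun h (x, a) then (1 : ℝ) else 0)
        (fun a _ => by positivity) (Finset.mem_univ a))
    · positivity
  have hcard : (Fintype.card (α × (Bool × Bool)) : ℝ) = Fintype.card α * 4 := by
    simp only [Fintype.card_prod, Fintype.card_bool]
    norm_num
  rw [fullDensity, l1Dist, hcard, div_div, fullPoints, ← Finset.sum_boole, Fintype.sum_prod_type]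
  simp only [abs_toNat_sub_toNat_eq_ite]
  gcongr with x
  exact hpoint x

lemma le_l1Dist_of_mem_families {n : ℕ} {f₀ f₁ : Input n → Bool} (h₀ : f₀ ∈ familyZero n)
    (h₁ : f₁ ∈ familyOne n) : 1 / 64 ≤ l1Dist f₀ f₁ := by
  obtain ⟨g, hdense, rfl⟩ := mem_familyZero_iff.mp h₀
  obtain ⟨w, rfl⟩ := mem_familyOne_iff.mp h₁
  linarith [fullDensity_div_four_le_l1Dist (g := g) (fullPoints_appendParity_comp w)]

end Distance

section Queries

namespace QueryAlgorithm

lemma prob_false_add_prob_true {X : Type} {q : ℕ} (R : QueryAlgorithm X q) (f : X → Bool) :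
    R.prob f false + R.prob f true = 1 := by
  rw [prob, prob, ← ENNReal.toReal_add (PMF.apply_ne_top _ _) (PMF.apply_ne_top _ _), add_comm,
    ← Fintype.sum_bool, ← tsum_fintype (L := .unconditional _), PMF.tsum_coe, ENNReal.toReal_one]

end QueryAlgorithm

/-- Reads the three bits stored at each point of the list and answers `false` as soon as all three
are set. -/
def searchTree {α : Type} : List α → DecisionTree (α × (Bool × Bool))
  | [] => .leaf true
  | x :: l => .query (x, (false, false)) fun a => .query (x, (false, true)) fun b =>
      .query (x, (true, false)) fun c => if a && b && c then .leaf false else searchTree l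

lemma depth_searchTree_le {α : Type} (l : List α) : (searchTree l).depth ≤ 3 * l.length := by
  induction l with
  | nil => exact Nat.zero_le _
  | cons x l ih =>
    simp only [searchTree, DecisionTree.depth, List.length_cons, Bool.and_false,
      Bool.and_true, Bool.false_eq_true, if_true, if_false]
    omega

variable {α : Type} [Fintype α]

lemma eval_searchTree_eq_true_iff (g : α → Bool × Bool × Bool) (l : List α) :
    (searchTree l).eval (tableFun g) = true ↔ ∀ x ∈ l, x ∉ fullPoints g := by
  induction l with
  | nil => simp [searchTree, DecisionTree.eval]
  | cons x l ih =>
    have hfull : (tableFun g (x, (false, false)) && tableFun g (x, (false, true)) &&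
        tableFun g (x, (true, false))) = true ↔ x ∈ fullPoints g := by
      simp [tableFun, tableEntry, fullPoints, Prod.ext_iff, and_assoc]
    rw [List.forall_mem_cons, ← ih, ← hfull]
    simp only [searchTree, DecisionTree.eval]
    split_ifs with hx <;> simp [hx, DecisionTree.eval]

/-- Searches for a full point of a table among `k` independent uniform samples. -/
noncomputable def searchAlgorithm (α : Type) [Fintype α] [Nonempty α] (k : ℕ) :
    QueryAlgorithm (α × (Bool × Bool)) (3 * k) where
  dist := (PMF.uniformOfFintype (Fin k → α)).map fun z => searchTree (List.ofFn z)
  depth_le T hT := by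
    obtain ⟨z, -, rfl⟩ := (PMF.mem_support_map_iff _ _ _).mp hT
    simpa using depth_searchTree_le (List.ofFn z)

lemma prob_searchAlgorithm_true [Nonempty α] (k : ℕ) (g : α → Bool × Bool × Bool) :
    (searchAlgorithm α k).prob (tableFun g) true = (1 - fullDensity g) ^ k := by
  classical
  have hmiss : (fun z : Fin k → α => (searchTree (List.ofFn z)).eval (tableFun g)) ⁻¹' {true} =
      (Fintype.piFinset fun _ => (fullPoints g)ᶜ : Finset (Fin k → α)) := by
    ext z
    simp [eval_searchTree_eq_true_iff]
  have hα : (Fintype.card α : ℝ) ≠ 0 := Nat.cast_ne_zero.mpr Fintype.card_ne_zero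
  rw [QueryAlgorithm.prob, searchAlgorithm, PMF.map_comp, ← PMF.toOuterMeasure_apply_singleton,
    PMF.toOuterMeasure_map_apply, Function.comp_def, hmiss,
    PMF.toOuterMeasure_uniformOfFintype_apply]
  simp only [Fintype.card_coe, SetLike.coe_sort_coe]
  rw [Fintype.card_piFinset_const, Fintype.card_fun, Fintype.card_fin, Finset.card_compl,
    ENNReal.toReal_div, ENNReal.toReal_natCast, ENNReal.toReal_natCast, Nat.cast_pow, Nat.cast_pow,
    Nat.cast_sub (Finset.card_le_univ _), ← div_pow, sub_div, div_self hα, fullDensity]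

lemma searchAlgorithm_distinguishes (n : ℕ) :
    (searchAlgorithm (Cube n) 18).Distinguishes (familyZero n) (familyOne n) (2 / 3) := by
  constructor <;> intro f hf
  · obtain ⟨g, hdense, rfl⟩ := mem_familyZero_iff.mp hf
    have hmiss : (1 - fullDensity g) ^ 18 ≤ 1 / 3 :=
      (pow_le_pow_left₀ (sub_nonneg.mpr (fullDensity_le_one g)) (by linarith) 18).trans
        (by norm_num : (15 / 16 : ℝ) ^ 18 ≤ 1 / 3)
    linarith [(searchAlgorithm (Cube n) 18).prob_false_add_prob_true (tableFun g),
      prob_searchAlgorithm_true 18 g]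
  · obtain ⟨w, rfl⟩ := mem_familyOne_iff.mp hf
    rw [prob_searchAlgorithm_true, fullDensity, fullPoints_appendParity_comp]
    norm_num

end Queries

theorem mainTheorem3 :
    -- the two families are non-empty and at distance at least `1/64`
    (∀ n : ℕ, (familyZero n).Nonempty ∧ (familyOne n).Nonempty ∧
      ∀ f₀ ∈ familyZero n, ∀ f₁ ∈ familyOne n, (1 / 64 : ℝ) ≤ l1Dist f₀ f₁) ∧
    -- passive quantum testers need `Ω(2^{n/2})` copies
    (∃ c : ℝ, 0 < c ∧ ∀ (n t : ℕ) (M : PassiveQuantumTester (Input n) t),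
      M.Distinguishes (familyZero n) (familyOne n) (2 / 3) →
        c * (2 : ℝ) ^ ((n : ℝ) / 2) ≤ (t : ℝ)) ∧
    -- a constant number of classical queries suffices
    (∃ q : ℕ, ∀ n : ℕ, ∃ R : QueryAlgorithm (Input n) q,
      R.Distinguishes (familyZero n) (familyOne n) (2 / 3)) ∧
    -- the averaged states agree on the distinct-input subspace
    (∀ n t : ℕ, distinctProj n t * ensembleZero n t * distinctProj n t =
      distinctProj n t * ensembleOne n t * distinctProj n t) ∧
    -- the projection moves them by `O(t / 2^{n/2})`, and they are `O(t / 2^{n/2})`-close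
    (∃ K : ℝ, 0 < K ∧ ∀ n t : ℕ,
      traceNorm (ensembleZero n t - distinctProj n t * ensembleZero n t * distinctProj n t) ≤
        K * ((t : ℝ) / (2 : ℝ) ^ ((n : ℝ) / 2)) ∧
      traceNorm (ensembleOne n t - distinctProj n t * ensembleOne n t * distinctProj n t) ≤
        K * ((t : ℝ) / (2 : ℝ) ^ ((n : ℝ) / 2)) ∧
      traceNorm (ensembleZero n t - ensembleOne n t) ≤
        K * ((t : ℝ) / (2 : ℝ) ^ ((n : ℝ) / 2))) := by
  refine ⟨fun n => ⟨familyZero_nonempty n, familyOne_nonempty n, fun f₀ h₀ f₁ h₁ =>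
      le_l1Dist_of_mem_families h₀ h₁⟩,
    ⟨1 / 64, by norm_num, fun n t M hM => hM.le_copies⟩,
    ⟨3 * 18, fun n => ⟨searchAlgorithm (Cube n) 18, searchAlgorithm_distinguishes n⟩⟩,
    distinctProj_mul_ensembleZero_mul_distinctProj, ⟨4, by norm_num, fun n t => ?_⟩⟩
  have hdouble : 2 * (t / (2 : ℝ) ^ ((n : ℝ) / 2)) ≤ 4 * (t / (2 : ℝ) ^ ((n : ℝ) / 2)) := by
    gcongr
    norm_num
  exact ⟨(traceNorm_ensembleZero_sub_distinctProj_le n t).trans hdouble,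
    (traceNorm_ensembleOne_sub_distinctProj_le n t).trans hdouble,
    traceNorm_ensembleZero_sub_ensembleOne_le n t⟩
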